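/- **Proposition 3.4.** Let $A$ be a von Neumann algebra acting on a complex Hilbert space and let $a\in A$ be self-adjoint. Let $\mathcal V(A)$ be the poset of abelian von Neumann subalgebras $C\subseteq A$ with the same unit as $A$ ("contexts"), ordered by inclusion and equipped with the Alexandrov topology (open sets are up-sets); let $\uparrow C=\{C'\in\mathcal V(A): C\subseteq C'\}$, and let $\Sigma_C$ be the Gelfand spectrum of $C$ (the characters of $C$ with the weak* topology). For self-adjoint $b,c$ write $b\le_s c$ (spectral order) if $\chi_{(-\infty,t]}(c)\le\chi_{(-\infty,t]}(b)$ for all $t\in\mathbb R$. For $C\in\mathcal V(A)$ put $$\delta^o(a)_C=\bigwedge\{b\in C_{sa}: a\le_s b\},\qquad \delta^i(a)_C=\bigvee\{b\in C_{sa}: b\le_s a\},$$ infimum and supremum being taken in $(C_{sa},\le_s)$. Let $\Sigma_*=\{(C,\lambda): C\in\mathcal V(A),\ \lambda\in\Sigma_C\}$, where $U\subseteq\Sigma_*$ is open iff (1) $U_C=\{\lambda:(C,\lambda)\in U\}$ is open in $\Sigma_C$ for every $C$, and (2) if $\lambda\in U_C$, $C\subseteq C'$, $\lambda'\in\Sigma_{C'}$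 and $\lambda'|_C=\lambda$, then $\lambda'\in U_{C'}$. Let $\mathbb{IR}$ be Scott's interval domain: the compact intervals $[r,s]$ with $r\le s$ in $\mathbb R$, ordered by reverse inclusion, with the Scott topology; for rationals $p<q$ put $(p,q)_S=\{[r,s]: p<r\le s<q\}$. In the topos $[\mathcal V(A),\mathbf{Set}]$ of covariant functors, let $\underline{\Sigma}_*$ and $\underline{\mathbb{IR}}$ be the internal locales whose internal frames are $$\mathcal O\underline{\Sigma}_*(C)=\Big\{U\subseteq\Sigma_*\text{ open}: U\subseteq\Sigma_*|_{\uparrow C}\Big\},\qquad \mathcal O\underline{\mathbb{IR}}(C)=\{W\subseteq\mathcal V(A)\times\mathbb{IR}\text{ open}: W\subseteq\ \uparrow C\times\mathbb{IR}\},$$ where $\Sigma_*|_{\uparrow C}=\coprod_{C'\in\uparrow C}\Sigma_{C'}$, with transition maps for $C\subseteq D$ given by intersection with $\Sigma_*|_{\uparrow D}$ and $\uparrow D\times\mathbb{IR}$, respectively. Then: 1. for every context $C$ the supremum $\delta^i(a)_C$ and the infimum $\delta^o(a)_C$ exist, and for every $(C,\lambda)\in\Sigma_*$ the numbers $\lambda(\delta^i(a)_C)\le\lambda(\delta^o(a)_C)$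 are real, so that $$\delta(a):\Sigma_*\to\mathbb{IR},\qquad (C,\lambda)\mapsto[\lambda(\delta^i(a)_C),\lambda(\delta^o(a)_C)]$$ is well defined; 2. $\delta(a)$ is continuous; 3. the prescription $$\underline\delta(a)^{-1}_C\big(\uparrow C'\times(p,q)_S\big)=\delta(a)^{-1}\big((p,q)_S\big)\cap\Sigma_*|_{\uparrow C'}\qquad(C\subseteq C',\ p<q\text{ rational})$$ defines an internal frame map $\underline\delta(a)^{-1}:\mathcal O\underline{\mathbb{IR}}\to\mathcal O\underline{\Sigma}_*$ in $[\mathcal V(A),\mathbf{Set}]$ (there is exactly one internal frame map satisfying it), that is, an internal locale map $\underline\delta(a):\underline{\Sigma}_*\to\underline{\mathbb{IR}}$. -/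

import Mathlib

open CategoryTheory TopologicalSpace

namespace Daseinisation

universe u v

/-! ### Locales internal to the topos of covariant functors on a poset

Let `P` be a preorder.  All notions below are the Kripke-Joyal translations, in the topos
`[P, Set]`, of the usual notions for posets and frames.  A generalized element at stage `C` of the
power object of `F : P ⥤ Type` is a subfunctor of the restriction of `F` to `↑C`; extending it by
the empty set outside the up-set `↑C`, it is a subfunctor of `F`.  As the notions below only look
at a subfunctor at stages `D ≥ C`, we quantify over subfunctors of `F`. -/

/-- A partially ordered object of the topos `[P, Set]`: a functor with a partial order at each
stage, such that the order relation is a subfunctor of the square of the functor. -/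
structure InternalPoset (P : Type u) [Preorder P] where
  carrier : P ⥤ Type v
  order : ∀ C : P, PartialOrder (carrier.obj C)
  map_mono : ∀ {C D : P} (f : C ⟶ D), Monotone (carrier.map f)

attribute [instance] InternalPoset.order

namespace InternalPoset

variable {P : Type u} [Preorder P] (L : InternalPoset.{u, v} P)

/-- `C ⊩ t` is the largest element of `L`. -/
def IsTopAt (C : P) (t : L.carrier.obj C) : Prop :=
  ∀ (D : P) (f : C ⟶ D) (v : L.carrier.obj D), v ≤ L.carrier.map f t

/-- `C ⊩ m` is the greatest lower bound of `x` and `y`. -/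
def IsMeetAt (C : P) (x y m : L.carrier.obj C) : Prop :=
  ∀ (D : P) (f : C ⟶ D),
    IsGLB {L.carrier.map f x, L.carrier.map f y} (L.carrier.map f m)

/-- `C ⊩ w` is an upper bound of `S`. -/
def IsUpperBoundAt (S : Subfunctor L.carrier) (C : P) (w : L.carrier.obj C) : Prop :=
  ∀ (D : P) (f : C ⟶ D), ∀ s ∈ S.obj D, s ≤ L.carrier.map f w

/-- `C ⊩ w` is the least upper bound of `S`. -/
def IsJoinAt (S : Subfunctor L.carrier) (C : P) (w : L.carrier.obj C) : Prop :=
  L.IsUpperBoundAt S C w ∧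
    ∀ (D : P) (f : C ⟶ D) (v : L.carrier.obj D),
      L.IsUpperBoundAt S D v → L.carrier.map f w ≤ v

/-- The subobject `{x ∧ s | s ∈ S}` of `L`, where `x` is a generalized element at stage `C`. -/
def meetWith {C : P} (x : L.carrier.obj C) (S : Subfunctor L.carrier) :
    Subfunctor L.carrier where
  obj D := {w | ∃ f : C ⟶ D, ∃ s ∈ S.obj D, L.IsMeetAt D (L.carrier.map f x) s w}
  map := by
    rintro D E g w ⟨f, s, hs, hw⟩
    refine ⟨f ≫ g, L.carrier.map g s, S.map g hs, ?_⟩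
    intro F h
    simpa using hw F (g ≫ h)

/-- The internal poset `L` is a frame in `[P, Set]`: it has finite meets, it has a join for each
of its subobjects, and binary meets distribute over these joins. -/
structure IsFrame : Prop where
  exists_top : ∀ C, ∃ t, L.IsTopAt C t
  exists_meet : ∀ C (x y : L.carrier.obj C), ∃ m, L.IsMeetAt C x y m
  exists_join : ∀ C (S : Subfunctor L.carrier), ∃ w, L.IsJoinAt S C w
  meet_join : ∀ C (x : L.carrier.obj C) (S : Subfunctor L.carrier) (w m : L.carrier.obj C),
    L.IsJoinAt S C w → L.IsMeetAt C x w m → L.IsJoinAt (L.meetWith x S) C m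

end InternalPoset

/-- A locale internal to `[P, Set]`, given by its internal frame of opens. -/
structure InternalLocale (P : Type u) [Preorder P] where
  opens : InternalPoset.{u, v} P
  isFrame : opens.IsFrame

/-- A frame map in `[P, Set]`: a natural transformation that preserves, internally, finite meets
and joins of arbitrary subobjects. -/
structure InternalFrameHom {P : Type u} [Preorder P] (L M : InternalPoset.{u, v} P) where
  toNatTrans : L.carrier ⟶ M.carrier
  map_top : ∀ C (t : L.carrier.obj C), L.IsTopAt C t → M.IsTopAt C (toNatTrans.app C t)
  map_meet : ∀ C (x y m : L.carrier.obj C), L.IsMeetAt C x y m →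
    M.IsMeetAt C (toNatTrans.app C x) (toNatTrans.app C y) (toNatTrans.app C m)
  map_join : ∀ C (S : Subfunctor L.carrier) (w : L.carrier.obj C), L.IsJoinAt S C w →
    M.IsJoinAt (S.image toNatTrans) C (toNatTrans.app C w)

/-- An internal locale map `X ⟶ Y` is an internal frame map from the opens of `Y` to the opens
of `X` (taking inverse images). -/
structure InternalLocaleMap {P : Type u} [Preorder P] (X Y : InternalLocale.{u, v} P) where
  preimage : InternalFrameHom Y.opens X.opens

section Bundle

variable {P : Type u} [Preorder P] [TopologicalSpace P] [Topology.IsUpperSet P]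
  {Y : Type v} [TopologicalSpace Y] (π : Y → P) (hπ : Continuous π)

/-- The functor `C ↦ {U open in Y | U ⊆ π⁻¹(↑C)}`, with transition maps `U ↦ U ∩ π⁻¹(↑D)`, for
a continuous map `π` to `P` with the Alexandrov topology (the open sets are the up-sets). -/
def bundleOpens : P ⥤ Type v where
  obj C := {U : Opens Y // ∀ y ∈ U, C ≤ π y}
  map {C D} f := ↾fun U => ⟨⟨(U.1 : Set Y) ∩ π ⁻¹' Set.Ici D,
    U.1.isOpen.inter ((Topology.IsUpperSet.isOpen_iff_isUpperSet.2 (isUpperSet_Ici D)).preimage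
      hπ)⟩, fun _ hy => hy.2⟩
  map_id C := by
    ext U y
    exact ⟨fun h => h.1, fun h => ⟨h, U.2 y h⟩⟩
  map_comp {C D E} f g := by
    ext U y
    exact ⟨fun h => ⟨⟨h.1, g.le.trans h.2⟩, h.2⟩, fun h => ⟨h.1.1, h.2⟩⟩

/-- The opens of a bundle, ordered by inclusion. -/
def bundlePoset : InternalPoset.{u, v} P where
  carrier := bundleOpens π hπ
  order C := inferInstanceAs (PartialOrder {U : Opens Y // ∀ y ∈ U, C ≤ π y})
  map_mono _ _ _ h := fun _ hy => ⟨h hy.1, hy.2⟩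

theorem bundlePoset_isFrame : (bundlePoset π hπ).IsFrame where
  exists_top C := by
    refine ⟨⟨⟨π ⁻¹' Set.Ici C, (Topology.IsUpperSet.isOpen_iff_isUpperSet.2
      (isUpperSet_Ici C)).preimage hπ⟩, fun _ hy => hy⟩, ?_⟩
    intro D f v y hy
    exact ⟨f.le.trans (v.2 y hy), v.2 y hy⟩
  exists_meet C x y := by
    refine ⟨⟨x.1 ⊓ y.1, fun z hz => x.2 z hz.1⟩, ?_⟩
    intro D f
    refine ⟨?_, ?_⟩
    · rintro w (rfl | rfl)
      · exact fun z hz => ⟨hz.1.1, hz.2⟩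
      · exact fun z hz => ⟨hz.1.2, hz.2⟩
    · intro w hw z hz
      have h1 := hw (Set.mem_insert _ _) hz
      have h2 := hw (Set.mem_insert_of_mem _ rfl) hz
      exact ⟨⟨h1.1, h2.1⟩, h1.2⟩
  exists_join C S := by
    refine ⟨⟨⟨⋃ (D : P) (_ : C ≤ D) (s ∈ S.obj D), (s.1 : Set Y), ?_⟩, ?_⟩, ?_, ?_⟩
    · exact isOpen_iUnion fun D => isOpen_iUnion fun _ => isOpen_iUnion fun s =>
        isOpen_iUnion fun _ => s.1.isOpen
    · intro y hy
      obtain ⟨D, hD, s, -, hy⟩ : ∃ D, ∃ _ : C ≤ D, ∃ s, ∃ _ : s ∈ S.obj D, y ∈ (s.1 : Set Y) := by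
        simpa only [← SetLike.mem_coe, Opens.coe_mk, Set.mem_iUnion] using hy
      exact hD.trans (s.2 y hy)
    · intro D f s hs y hy
      refine ⟨?_, s.2 y hy⟩
      exact Set.mem_iUnion.2 ⟨D, Set.mem_iUnion.2 ⟨f.le, Set.mem_iUnion.2 ⟨s,
        Set.mem_iUnion.2 ⟨hs, hy⟩⟩⟩⟩
    · intro D f v hv y hy
      obtain ⟨hy, hDy⟩ := hy
      obtain ⟨E, hE, s, hs, hy⟩ :
          ∃ E, ∃ _ : C ≤ E, ∃ s, ∃ _ : s ∈ S.obj E, y ∈ (s.1 : Set Y) := by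
        simpa only [Opens.coe_mk, Set.mem_iUnion] using hy
      have h1 := hv (π y) (homOfLE hDy) _ (S.map (homOfLE (s.2 y hy)) hs)
      exact (h1 (show y ∈ (s.1 : Set Y) ∩ π ⁻¹' Set.Ici (π y) from ⟨hy, le_rfl⟩)).1
  meet_join C x S w m hw hm := by
    have hmx : m ≤ x := by
      have h := (hm C (𝟙 C)).1 (Set.mem_insert _ _)
      simpa using h
    have hmw : m ≤ w := by
      have h := (hm C (𝟙 C)).1 (Set.mem_insert_of_mem _ rfl)
      simpa using h
    refine ⟨?_, ?_⟩
    · rintro D f z ⟨g, s, hs, hz⟩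
      have hzx : z ≤ (bundlePoset π hπ).carrier.map g x := by
        have h := (hz D (𝟙 D)).1 (Set.mem_insert _ _)
        simpa using h
      have hzs : z ≤ s := by
        have h := (hz D (𝟙 D)).1 (Set.mem_insert_of_mem _ rfl)
        simpa using h
      refine (hm D f).2 ?_
      rintro t (rfl | rfl)
      · exact hzx
      · exact hzs.trans (hw.1 D f s hs)
    · intro D f v hv y hy
      obtain ⟨hym, hDy⟩ := hy
      have hCy : C ≤ π y := f.le.trans hDy
      by_contra hyv
      -- the largest open over `↑(π y)` whose intersection with `x` lies in `v`
      let T : Set (Opens Y) := {U | (∀ z ∈ U, π y ≤ π z) ∧ ∀ z ∈ U, z ∈ x.1 → z ∈ v.1}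
      let b : (bundlePoset π hπ).carrier.obj (π y) := ⟨sSup T, by
        intro z hz
        obtain ⟨U, hU, hz⟩ := Opens.mem_sSup.1 hz
        exact hU.1 z hz⟩
      have hb : (bundlePoset π hπ).IsUpperBoundAt S (π y) b := by
        intro E g s hs z hz
        refine ⟨Opens.mem_sSup.2 ⟨s.1, ⟨fun z hz => g.le.trans (s.2 z hz), ?_⟩, hz⟩, s.2 z hz⟩
        intro z hz hzx
        let q : (bundlePoset π hπ).carrier.obj E :=
          ⟨x.1 ⊓ s.1, fun z hz => s.2 z hz.2⟩
        have hq : q ∈ ((bundlePoset π hπ).meetWith x S).obj E := by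
          refine ⟨homOfLE (hCy.trans g.le), s, hs, ?_⟩
          intro F h
          refine ⟨?_, ?_⟩
          · rintro t (rfl | rfl)
            · exact fun z hz => ⟨⟨hz.1.1, h.le.trans hz.2⟩, hz.2⟩
            · exact fun z hz => ⟨hz.1.2, hz.2⟩
          · intro t ht z hz
            have h1 := ht (Set.mem_insert _ _) hz
            have h2 := ht (Set.mem_insert_of_mem _ rfl) hz
            exact ⟨⟨h1.1.1, h2.1⟩, h1.2⟩
        exact (hv E (homOfLE (le_trans hDy g.le)) q hq (show z ∈ q.1 from ⟨hzx, hz⟩)).1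
      have h1 := hw.2 (π y) (homOfLE hCy) b hb (show y ∈ (w.1 : Set Y) ∩ π ⁻¹' Set.Ici (π y) from
        ⟨hmw hym, le_rfl⟩)
      obtain ⟨U, hU, hyU⟩ := Opens.mem_sSup.1 h1
      exact hyv (hU.2 y hyU (hmx hym))

/-- The locale internal to `[P, Set]` whose external description is the bundle `π : Y → P`. -/
def bundleLocale : InternalLocale.{u, v} P where
  opens := bundlePoset π hπ
  isFrame := bundlePoset_isFrame π hπ

end Bundle

/-! ### Scott's interval domain -/

/-- Scott's interval domain: the compact intervals `[r, s]` with `r ≤ s`, ordered by reverse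
inclusion (Mathlib orders `NonemptyInterval ℝ` by inclusion). -/
def IntervalDomain : Type := (NonemptyInterval ℝ)ᵒᵈ

namespace IntervalDomain

instance : PartialOrder IntervalDomain := inferInstanceAs (PartialOrder (NonemptyInterval ℝ)ᵒᵈ)

instance : TopologicalSpace IntervalDomain := Topology.scott IntervalDomain Set.univ

instance : Topology.IsScott IntervalDomain Set.univ := ⟨rfl⟩

/-- The left endpoint of an interval. -/
def lo (I : IntervalDomain) : ℝ := (OrderDual.ofDual I : NonemptyInterval ℝ).fst

/-- The right endpoint of an interval. -/
def hi (I : IntervalDomain) : ℝ := (OrderDual.ofDual I : NonemptyInterval ℝ).snd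

/-- The interval with endpoints `r` and `s`; it is `[r, s]` if `r ≤ s`. -/
noncomputable def mk (r s : ℝ) : IntervalDomain :=
  OrderDual.toDual (⟨(min r s, max r s), min_le_max⟩ : NonemptyInterval ℝ)

/-- `(p, q)_S = {[r, s] | p < r ≤ s < q}`. -/
def basic (p q : ℚ) : Set IntervalDomain := {I | (p : ℝ) < I.lo ∧ I.hi < (q : ℝ)}

theorem le_iff {I J : IntervalDomain} : I ≤ J ↔ I.lo ≤ J.lo ∧ J.hi ≤ I.hi := Iff.rfl

theorem lo_le_hi (I : IntervalDomain) : I.lo ≤ I.hi :=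
  (OrderDual.ofDual I : NonemptyInterval ℝ).fst_le_snd

theorem isOpen_basic (p q : ℚ) : IsOpen (basic p q) := by
  rw [Topology.IsScott.isOpen_iff_isUpperSet_and_dirSupInaccOn (D := Set.univ)]
  refine ⟨fun I J hIJ hI => ⟨hI.1.trans_le (le_iff.1 hIJ).1, (le_iff.1 hIJ).2.trans_lt hI.2⟩, ?_⟩
  intro d _ hne hdir I hI hIm
  have h1 : ∃ J ∈ d, (p : ℝ) < J.lo := by
    by_contra! h
    have hpI : (p : ℝ) ≤ I.hi := hIm.1.le.trans I.lo_le_hi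
    have hb : I ≤ OrderDual.toDual (⟨(p, I.hi), hpI⟩ : NonemptyInterval ℝ) :=
      hI.2 fun J hJ => ⟨h J hJ, (le_iff.1 (hI.1 hJ)).2⟩
    exact absurd hIm.1 (not_lt.2 (le_iff.1 hb).1)
  have h2 : ∃ J ∈ d, J.hi < (q : ℝ) := by
    by_contra! h
    have hqI : I.lo ≤ (q : ℝ) := I.lo_le_hi.trans hIm.2.le
    have hb : I ≤ OrderDual.toDual (⟨(I.lo, (q : ℝ)), hqI⟩ : NonemptyInterval ℝ) :=
      hI.2 fun J hJ => ⟨(le_iff.1 (hI.1 hJ)).1, h J hJ⟩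
    exact absurd hIm.2 (not_lt.2 (le_iff.1 hb).2)
  obtain ⟨J, hJ, hpJ⟩ := h1
  obtain ⟨K, hK, hKq⟩ := h2
  obtain ⟨M, hM, hJM, hKM⟩ := hdir J hJ K hK
  exact ⟨M, hM, hpJ.trans_le (le_iff.1 hJM).1, (le_iff.1 hKM).2.trans_lt hKq⟩

end IntervalDomain

/-! ### Spectral order and daseinisation -/

section Spectral

variable {H : Type u} [NormedAddCommGroup H] [InnerProductSpace ℂ H] [CompleteSpace H]

/-- The spectral projection `e_t = χ_{(-∞, t]}(a)` of a self-adjoint operator `a`.  Since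
`χ_{(-∞, t]}(s) = 1` exactly when `(s - t)⁺ = 0`, it is the orthogonal projection onto the kernel
of `(a - t)⁺`, where the positive part is taken in the continuous functional calculus. -/
noncomputable def spectralProj (a : H →L[ℂ] H) (t : ℝ) : H →L[ℂ] H :=
  (LinearMap.ker (cfc (fun s : ℝ => max (s - t) 0) a).toLinearMap).starProjection

/-- The spectral order `a ≤ₛ b` on self-adjoint operators: `χ_{(-∞, t]}(b) ≤ χ_{(-∞, t]}(a)` for
all real `t`. -/
def SpectralLE (a b : H →L[ℂ] H) : Prop :=
  ∀ t : ℝ, spectralProj b t ≤ spectralProj a t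

/-- A context of `A`: an abelian von Neumann subalgebra with the same unit. -/
structure Context (A : VonNeumannAlgebra H) where
  alg : VonNeumannAlgebra H
  le : alg ≤ A
  comm : ∀ x ∈ alg, ∀ y ∈ alg, x * y = y * x

/-- The poset `V(A)` of contexts, ordered by inclusion. -/
instance (A : VonNeumannAlgebra H) : PartialOrder (Context A) :=
  PartialOrder.lift Context.alg fun C D h => by cases C; cases D; cases h; rfl

/-- `V(A)` carries the Alexandrov topology: the open sets are the up-sets. -/
instance (A : VonNeumannAlgebra H) : TopologicalSpace (Context A) := Topology.upperSet _

instance (A : VonNeumannAlgebra H) : Topology.IsUpperSet (Context A) := ⟨rfl⟩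

variable {A : VonNeumannAlgebra H}

/-- The context `C` as a *-algebra in its own right. -/
abbrev Context.carrier (C : Context A) : Type u := C.alg.toStarSubalgebra

/-- The self-adjoint part `C_sa` of a context, as a set with the spectral order. -/
structure SelfAdjointPart (C : Context A) where
  val : C.carrier
  isSelfAdjoint : IsSelfAdjoint val

/-- `C_sa` is (pre)ordered by the spectral order. -/
instance (C : Context A) : Preorder (SelfAdjointPart C) where
  le b c := SpectralLE (b.val : H →L[ℂ] H) (c.val : H →L[ℂ] H)
  le_refl _ _ := le_rfl
  le_trans _ _ _ h₁ h₂ t := (h₂ t).trans (h₁ t)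

/-- `{b ∈ C_sa | a ≤ₛ b}`. -/
def outerSet (a : H →L[ℂ] H) (C : Context A) : Set (SelfAdjointPart C) :=
  {b | SpectralLE a (b.val : H →L[ℂ] H)}

/-- `{b ∈ C_sa | b ≤ₛ a}`. -/
def innerSet (a : H →L[ℂ] H) (C : Context A) : Set (SelfAdjointPart C) :=
  {b | SpectralLE (b.val : H →L[ℂ] H) a}

open Classical in
/-- The outer daseinisation `δᵒ(a)_C = ⋀ {b ∈ C_sa | a ≤ₛ b}`, the infimum in `C_sa` for the
spectral order (zero if there were none). -/
noncomputable def outerDas (a : H →L[ℂ] H) (C : Context A) : SelfAdjointPart C :=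
  if h : ∃ d, IsGLB (outerSet a C) d then h.choose else ⟨0, .zero _⟩

open Classical in
/-- The inner daseinisation `δⁱ(a)_C = ⋁ {b ∈ C_sa | b ≤ₛ a}`, the supremum in `C_sa` for the
spectral order (zero if there were none). -/
noncomputable def innerDas (a : H →L[ℂ] H) (C : Context A) : SelfAdjointPart C :=
  if h : ∃ d, IsLUB (innerSet a C) d then h.choose else ⟨0, .zero _⟩

/-! ### The spectral bundle and the covariant daseinisation map -/

/-- The Gelfand spectrum of a context: its characters, with the weak* topology. -/
abbrev Context.spectrum (C : Context A) : Type u := WeakDual.characterSpace ℂ C.carrier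

variable (A) in
/-- The set of pairs `(C, χ)` with `C` a context and `χ` a character of `C`. -/
structure SpectralBundle where
  ctx : Context A
  char : ctx.spectrum

/-- The topology of `Σ_*`: a set `U` is open iff each `U_C` is open in the Gelfand spectrum of
`C`, and whenever `χ ∈ U_C`, `C ⊆ C'` and `χ'` is a character of `C'` that restricts to `χ`,
also `χ' ∈ U_{C'}`. -/
instance : TopologicalSpace (SpectralBundle A) where
  IsOpen U :=
    (∀ C : Context A, IsOpen {χ : C.spectrum | SpectralBundle.mk C χ ∈ U}) ∧
    ∀ (C C' : Context A) (h : C ≤ C') (χ : C.spectrum) (χ' : C'.spectrum),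
      (∀ c : C.carrier, χ' ⟨c.1, h c.2⟩ = χ c) →
        SpectralBundle.mk C χ ∈ U → SpectralBundle.mk C' χ' ∈ U
  isOpen_univ := ⟨fun _ => isOpen_univ, fun _ _ _ _ _ _ _ => trivial⟩
  isOpen_inter U V hU hV := ⟨fun C => (hU.1 C).inter (hV.1 C), fun C C' h χ χ' hχ hm =>
    ⟨hU.2 C C' h χ χ' hχ hm.1, hV.2 C C' h χ χ' hχ hm.2⟩⟩
  isOpen_sUnion S hS := by
    refine ⟨fun C => ?_, ?_⟩
    · have : {χ : C.spectrum | SpectralBundle.mk C χ ∈ ⋃₀ S} =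
          ⋃ U ∈ S, {χ : C.spectrum | SpectralBundle.mk C χ ∈ U} := by
        ext χ
        simp
      rw [this]
      exact isOpen_biUnion fun U hU => (hS U hU).1 C
    · rintro C C' h χ χ' hχ ⟨U, hU, hm⟩
      exact ⟨U, hU, (hS U hU).2 C C' h χ χ' hχ hm⟩

theorem continuous_ctx : Continuous (SpectralBundle.ctx : SpectralBundle A → Context A) := by
  refine continuous_def.2 fun V hV => ⟨fun C => ?_, fun C C' h χ χ' _ hm => ?_⟩
  · by_cases hC : C ∈ V
    · simp [Set.mem_preimage, hC]
    · simp [Set.mem_preimage, hC]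
  · exact Topology.IsUpperSet.isOpen_iff_isUpperSet.1 hV h hm

/-- The covariant daseinisation `δ(a) : (C, χ) ↦ [χ(δⁱ(a)_C), χ(δᵒ(a)_C)]`.  (Characters take real
values on self-adjoint elements, so that taking real parts changes nothing.) -/
noncomputable def covDas (a : H →L[ℂ] H) (x : SpectralBundle A) : IntervalDomain :=
  IntervalDomain.mk (x.char (innerDas a x.ctx).val).re (x.char (outerDas a x.ctx).val).re

variable (A) in
/-- The internal locale `Σ_*` in `[V(A), Set]`, with external description `(C, χ) ↦ C`. -/
def spectralLocale : InternalLocale.{u, u} (Context A) :=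
  bundleLocale (SpectralBundle.ctx : SpectralBundle A → Context A) continuous_ctx

variable (A) in
/-- The interval domain internal to `[V(A), Set]`, with external description the projection
`V(A) × IR → V(A)`. -/
def intervalLocale : InternalLocale.{u, u} (Context A) :=
  bundleLocale (Prod.fst : Context A × IntervalDomain → Context A) continuous_fst

/-- The open `↑C' × (p, q)_S` of the internal interval domain at stage `C`, for `C ≤ C'`. -/
def intervalBasic {C C' : Context A} (h : C ≤ C') (p q : ℚ) :
    (intervalLocale A).opens.carrier.obj C :=
  (⟨⟨Set.Ici C' ×ˢ IntervalDomain.basic p q,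
      (Topology.IsUpperSet.isOpen_iff_isUpperSet.2 (isUpperSet_Ici C')).prod
        (IntervalDomain.isOpen_basic p q)⟩, fun _ hy => h.trans hy.1⟩ :
    {U : Opens (Context A × IntervalDomain) // ∀ y ∈ U, C ≤ y.1})

/-- The subset of `Σ_*` underlying an open of the internal locale at stage `C`. -/
def spectralOpenSet {C : Context A} (U : (spectralLocale A).opens.carrier.obj C) :
    Set (SpectralBundle A) :=
  (Subtype.val (p := fun V : Opens (SpectralBundle A) => ∀ y ∈ V, C ≤ y.ctx) U :
    Opens (SpectralBundle A))

end Spectral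

end Daseinisation

namespace Daseinisation
universe u v

/-! ### The spectral order in terms of the functional calculus -/

section SpectralOrder

variable {H : Type u} [NormedAddCommGroup H] [InnerProductSpace ℂ H] [CompleteSpace H]

/-! The spectral order is first freed from projections: `a ≤ₛ b` iff `(a - t)⁺ (t - b)⁺ = 0` for
every real `t` (`spectralLE_iff_mul_eq_zero`). Taking adjoints shows that negation reverses this
relation. Inside a single context the Gelfand transform turns operators into functions, and there
the spectral order, the operator order and the pointwise order on characters coincide
(`Context.spectralLE_iff_char`, `Context.spectralLE_iff_le`).

Outer daseinisation exists because `{b ∈ C_sa | a ≤ₛ b}` contains the scalar `‖a‖` and is closed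
under minima. Its part below `‖a‖` is norm bounded and directed downwards, so it has a weak limit
`d` below all its members, and `d ∈ C` by the double commutant property. The estimate `(t - d)⁺ ≤ (t
- b)⁺ + (b - d)` shows that `a ≤ₛ d`, so the infimum is even a minimum (`exists_isLeast_outerSet`).
Inner daseinisation follows by negation.

Enlarging the context enlarges both approximating sets, so the interval `δ(a)(C, χ)` can only
shrink; together with weak* continuity over each fixed context this gives continuity on basic Scott
opens.

For opens of a bundle, internal tops, meets and joins are the expected set-theoretic ones. Hence
`(C, χ) ↦ (C, δ(a)(C, χ))`, a continuous map over `V(A)`, yields an internal frame map by preimage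
(`bundlePreimage`). It is the only one with the given values, since the boxes `↑C' × (p, q)_S` form
a basis and frame maps preserve joins (`bundlePoset_hom_ext`). -/

theorem apply_eq_zero_of_re_inner_nonpos {T : H →L[ℂ] H} (hT : 0 ≤ T) {x : H}
    (hx : (inner ℂ (T x) x).re ≤ 0) : T x = 0 := by
  obtain ⟨S, rfl⟩ := CStarAlgebra.nonneg_iff_eq_star_mul_self.1 hT
  have h : (inner ℂ ((star S * S) x) x).re = ‖S x‖ ^ 2 := by
    rw [mul_apply_eq_comp, ContinuousLinearMap.star_eq_adjoint,
      ContinuousLinearMap.adjoint_inner_left]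
    exact inner_self_eq_norm_sq (𝕜 := ℂ) (S x)
  rw [h] at hx
  have h0 : S x = 0 := by
    rw [← norm_eq_zero]
    exact pow_eq_zero_iff two_ne_zero |>.1 (le_antisymm hx (sq_nonneg _))
  simp [h0]

theorem re_inner_apply_mono {H : Type u} [NormedAddCommGroup H] [InnerProductSpace ℂ H]
    {S T : H →L[ℂ] H} (h : S ≤ T) (x : H) :
    (inner ℂ (S x) x).re ≤ (inner ℂ (T x) x).re := by
  have := ((ContinuousLinearMap.le_def S T).1 h).re_inner_nonneg_left x
  simpa [inner_sub_left] using this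

theorem apply_eq_zero_of_le {S T : H →L[ℂ] H} (hS : 0 ≤ S) (h : S ≤ T) {x : H} (hx : T x = 0) :
    S x = 0 := by
  refine apply_eq_zero_of_re_inner_nonpos hS ((re_inner_apply_mono h x).trans ?_)
  simp [hx]

/-- Orthogonal projections are ordered as their ranges, which here are kernels of positive parts. -/
theorem spectralLE_iff_ker {a b : H →L[ℂ] H} :
    SpectralLE a b ↔ ∀ (t : ℝ) (x : H), cfc (fun r : ℝ => max (r - t) 0) b x = 0 →
      cfc (fun r : ℝ => max (r - t) 0) a x = 0 := by
  refine forall_congr' fun t => ?_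
  rw [spectralProj, spectralProj, Submodule.starProjection_le_starProjection_iff]
  rfl

/-- A vector in the spectral subspace for `(-∞, t]` is in the range of the positive part of
`s - b` for `s > t`. -/
theorem exists_cfc_apply_eq {b : H →L[ℂ] H} (hb : IsSelfAdjoint b) {s t : ℝ} (hs : t < s) {x : H}
    (hx : cfc (fun r : ℝ => max (r - t) 0) b x = 0) :
    ∃ y, cfc (fun r : ℝ => max (s - r) 0) b y = x := by
  have hst : 0 < s - t := sub_pos.2 hs
  -- On `r ≤ t` this is `1 / (s - r)`; the cut-off at `s - t > 0` keeps it continuous everywhere.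
  have hk : Continuous fun r : ℝ => (max (s - r) (s - t))⁻¹ :=
    Continuous.inv₀ (by fun_prop) fun r => (hst.trans_le (le_max_right _ _)).ne'
  have hg : Continuous fun r : ℝ => 1 - max (s - r) 0 * (max (s - r) (s - t))⁻¹ := by fun_prop
  have h1 : ∀ r, max (r - t) 0 = 0 → max (s - r) 0 * (max (s - r) (s - t))⁻¹ = 1 := by
    intro r hr
    have hr : r - t ≤ 0 := hr ▸ le_max_left _ _
    rw [max_eq_left (by linarith), max_eq_left (by linarith), mul_inv_cancel₀ (by linarith)]
  -- The function vanishes for `r ≤ t` and is at most `(s - t)⁻¹ (r - t)⁺` elsewhere, so it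
  -- annihilates `x` because `(b - t)⁺` does.
  have h2 : cfc (fun r : ℝ => 1 - max (s - r) 0 * (max (s - r) (s - t))⁻¹) b x = 0 := by
    have hm : ∀ r, max (s - r) 0 * (max (s - r) (s - t))⁻¹ ≤ 1 := fun r => by
      rw [← div_eq_mul_inv]
      exact div_le_one_of_le₀ (max_le_max le_rfl hst.le) (hst.le.trans (le_max_right _ _))
    refine apply_eq_zero_of_le (T := cfc (fun r : ℝ => (s - t)⁻¹ * max (r - t) 0) b)
      (cfc_nonneg fun r _ => sub_nonneg.2 (hm r)) (cfc_mono (fun r _ => ?_) hg.continuousOn) ?_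
    · rcases le_total r t with hr | hr
      · rw [h1 r (max_eq_right (by linarith)), max_eq_right (by linarith)]
        simp
      · rw [max_eq_right (a := s - r) (b := s - t) (by linarith), mul_comm, ← sub_nonneg,
          max_eq_left (a := r - t) (by linarith)]
        have : (s - t)⁻¹ * (r - t) - (1 - (s - t)⁻¹ * max (s - r) 0) =
            (s - t)⁻¹ * (max (s - r) 0 - (s - r)) := by
          field_simp
          ring
        rw [this]
        exact mul_nonneg (inv_nonneg.2 hst.le) (sub_nonneg.2 (le_max_left _ _))
    · rw [cfc_const_mul _ _ b, smul_apply, hx, smul_zero]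
  refine ⟨cfc (fun r : ℝ => (max (s - r) (s - t))⁻¹) b x, ?_⟩
  rw [cfc_sub (fun _ => 1) _ b (by fun_prop) (by fun_prop), cfc_const_one ℝ b,
    cfc_mul (fun r : ℝ => max (s - r) 0) _ b (by fun_prop) hk.continuousOn,
    sub_apply, sub_eq_zero] at h2
  exact h2.symm

/-- The spectral order, expressed by the orthogonality of positive and negative parts. -/
theorem spectralLE_iff_mul_eq_zero {a b : H →L[ℂ] H} (ha : IsSelfAdjoint a)
    (hb : IsSelfAdjoint b) :
    SpectralLE a b ↔ ∀ t : ℝ,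
      cfc (fun r : ℝ => max (r - t) 0) a * cfc (fun r : ℝ => max (t - r) 0) b = 0 := by
  rw [spectralLE_iff_ker]
  constructor
  · intro h t
    ext x
    refine h t _ ?_
    change (cfc (fun r : ℝ => max (r - t) 0) b * cfc (fun r : ℝ => max (t - r) 0) b) x = 0
    rw [← cfc_mul (fun r : ℝ => max (r - t) 0) _ b]
    have : (fun r : ℝ => max (r - t) 0 * max (t - r) 0) = fun _ => 0 := by
      funext r
      rcases le_total r t with h | h
      · rw [max_eq_right (by linarith), zero_mul]
      · rw [max_eq_right (a := t - r) (by linarith), mul_zero]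
    rw [this, cfc_const_zero]
    rfl
  · intro h t x hx
    -- The hypothesis at level `s` kills the range of `(s - b)⁺`, which contains `x` only for `s >
    -- t`; the case `s = t` is then reached by a limit.
    have key : ∀ s, t < s → cfc (fun r : ℝ => max (r - s) 0) a x = 0 := by
      intro s hs
      obtain ⟨y, hy⟩ := exists_cfc_apply_eq hb hs hx
      rw [← hy]
      exact congrArg (fun T : H →L[ℂ] H => T y) (h s)
    refine apply_eq_zero_of_re_inner_nonpos (cfc_nonneg fun r _ => le_max_right _ _) ?_
    refine le_of_forall_pos_le_add fun ε hε => ?_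
    -- With `s = t + δ` one has `(a - t)⁺ ≤ (a - s)⁺ + δ`. This `δ` makes `δ ‖x‖² ≤ ε`, and the `+
    -- 1` covers `x = 0`.
    have hδ : 0 < ε / (‖x‖ ^ 2 + 1) := by positivity
    have h1 : cfc (fun r : ℝ => max (r - t) 0) a ≤
        cfc (fun r : ℝ => max (r - (t + ε / (‖x‖ ^ 2 + 1))) 0 + ε / (‖x‖ ^ 2 + 1)) a := by
      refine cfc_mono fun r _ => ?_
      refine max_le ?_ ?_
      · linarith [le_max_left (r - (t + ε / (‖x‖ ^ 2 + 1))) 0]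
      · linarith [le_max_right (r - (t + ε / (‖x‖ ^ 2 + 1))) 0]
    have h2 := re_inner_apply_mono h1 x
    rw [cfc_add a _ _ (by fun_prop) (by fun_prop), cfc_const _ a, add_apply, key (t + ε / (‖x‖ ^ 2 + 1)) (by linarith), zero_add,
      Algebra.algebraMap_eq_smul_one] at h2
    refine h2.trans ?_
    simp only [smul_apply, one_apply_eq_self, zero_add]
    rw [← Complex.coe_smul, inner_smul_left, Complex.conj_ofReal, Complex.re_ofReal_mul]
    have h3 : (inner ℂ x x).re = ‖x‖ ^ 2 := inner_self_eq_norm_sq (𝕜 := ℂ) x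
    rw [h3, div_mul_eq_mul_div, div_le_iff₀ (by positivity)]
    nlinarith [sq_nonneg ‖x‖]

theorem SpectralLE.trans {a b c : H →L[ℂ] H} (h : SpectralLE a b) (h' : SpectralLE b c) :
    SpectralLE a c :=
  fun t => (h' t).trans (h t)

/-- The adjoint of the product relation exchanges its factors, and negating an operator exchanges
positive and negative parts at `t` and `-t`. -/
theorem SpectralLE.neg {a b : H →L[ℂ] H} (ha : IsSelfAdjoint a) (hb : IsSelfAdjoint b)
    (h : SpectralLE a b) : SpectralLE (-b) (-a) := by
  rw [spectralLE_iff_mul_eq_zero hb.neg ha.neg]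
  intro t
  have h1 := congrArg star ((spectralLE_iff_mul_eq_zero ha hb).1 h (-t))
  rw [star_mul, star_zero, IsSelfAdjoint.cfc.star_eq, IsSelfAdjoint.cfc.star_eq] at h1
  have e1 : cfc (fun r : ℝ => max (r - t) 0) (-b) = cfc (fun r : ℝ => max (-t - r) 0) b := by
    refine (cfc_comp_neg (fun r : ℝ => max (r - t) 0) b (by fun_prop) hb).symm.trans
      (congrArg (fun f => cfc f b) ?_)
    funext r
    congr 1
    ring
  have e2 : cfc (fun r : ℝ => max (t - r) 0) (-a) = cfc (fun r : ℝ => max (r - -t) 0) a := by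
    refine (cfc_comp_neg (fun r : ℝ => max (t - r) 0) a (by fun_prop) ha).symm.trans
      (congrArg (fun f => cfc f a) ?_)
    funext r
    congr 1
    ring
  rw [e1, e2, h1]

/-- The spectrum of `a` lies below `‖a‖`, so one of the two factors vanishes for each `t`. This
makes the outer approximating set of every context nonempty. -/
theorem spectralLE_algebraMap_norm {a : H →L[ℂ] H} (ha : IsSelfAdjoint a) :
    SpectralLE a (algebraMap ℝ (H →L[ℂ] H) ‖a‖) := by
  rw [spectralLE_iff_mul_eq_zero ha (.algebraMap _ (.all _))]
  intro t
  rw [cfc_algebraMap]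
  rcases le_total t ‖a‖ with h | h
  · rw [max_eq_right (by linarith), map_zero, mul_zero]
  · have : cfc (fun r : ℝ => max (r - t) 0) a = cfc (fun _ : ℝ => (0 : ℝ)) a := by
      refine cfc_congr fun r hr => max_eq_right ?_
      have h1 := (le_abs_self r).trans (spectrum.norm_le_norm_mul_of_mem hr)
      have h2 : ‖a‖ * ‖(1 : H →L[ℂ] H)‖ ≤ ‖a‖ :=
        mul_le_of_le_one_right (norm_nonneg _) ContinuousLinearMap.norm_id_le
      linarith
    rw [this, cfc_const_zero, zero_mul]

theorem spectralLE_neg_algebraMap_norm {a : H →L[ℂ] H} (ha : IsSelfAdjoint a) :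
    SpectralLE (-algebraMap ℝ (H →L[ℂ] H) ‖a‖) a := by
  simpa using (spectralLE_algebraMap_norm ha.neg).neg ha.neg (.algebraMap _ (.all _))

end SpectralOrder
/-! ### Infima of directed sets of operators -/

section DirectedInf

open Filter Topology

variable {H : Type u} [NormedAddCommGroup H] [InnerProductSpace ℂ H]

/-- A norm-bounded family of operators converges weakly along each ultrafilter. -/
theorem exists_weak_limit [CompleteSpace H] (𝒰 : Ultrafilter (H →L[ℂ] H)) {M : ℝ}
    (hM : ∀ᶠ c in (𝒰 : Filter (H →L[ℂ] H)), ‖c‖ ≤ M) :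
    ∃ d : H →L[ℂ] H, ∀ x y : H,
      Tendsto (fun c : H →L[ℂ] H => inner ℂ (c x) y) 𝒰 (𝓝 (inner ℂ (d x) y)) := by
  have hbound : ∀ x y : H, ∀ᶠ c in (𝒰 : Filter (H →L[ℂ] H)),
      ‖inner ℂ (c x) y‖ ≤ M * ‖x‖ * ‖y‖ := fun x y => by
    filter_upwards [hM] with c hc
    calc ‖inner ℂ (c x) y‖ ≤ ‖c x‖ * ‖y‖ := norm_inner_le_norm _ _
      _ ≤ M * ‖x‖ * ‖y‖ := by
        gcongr
        exact (c.le_opNorm x).trans (by gcongr)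
  have hlim : ∀ x y : H, ∃ z : ℂ, ‖z‖ ≤ M * ‖x‖ * ‖y‖ ∧
      Tendsto (fun c : H →L[ℂ] H => inner ℂ (c x) y) 𝒰 (𝓝 z) := fun x y => by
    obtain ⟨z, hz, hz'⟩ := isCompact_iff_ultrafilter_le_nhds.1
      (isCompact_closedBall (0 : ℂ) (M * ‖x‖ * ‖y‖))
      (𝒰.map fun c : H →L[ℂ] H => inner ℂ (c x) y) (by
        rw [le_principal_iff, Ultrafilter.mem_coe, Ultrafilter.mem_map]
        filter_upwards [hbound x y] with c hc
        simpa using hc)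
    exact ⟨z, by simpa using hz, hz'⟩
  choose L hL hT using hlim
  -- The limits of matrix coefficients form a bounded sesquilinear form, which Riesz representation
  -- turns into an operator.
  let B : H →ₗ⋆[ℂ] H →ₗ[ℂ] ℂ := LinearMap.mk₂'ₛₗ _ _ L
    (fun x x' y => tendsto_nhds_unique (hT _ _)
      (by simpa [inner_add_left] using (hT x y).add (hT x' y)))
    (fun r x y => tendsto_nhds_unique (hT _ _)
      (by simpa [inner_smul_left, mul_comm] using (hT x y).const_mul (starRingEnd ℂ r)))
    (fun x y y' => tendsto_nhds_unique (hT _ _)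
      (by simpa [inner_add_right] using (hT x y).add (hT x y')))
    (fun r x y => tendsto_nhds_unique (hT _ _)
      (by simpa [inner_smul_right] using (hT x y).const_mul r))
  refine ⟨InnerProductSpace.continuousLinearMapOfBilin (B.mkContinuous₂ M hL), fun x y => ?_⟩
  rw [InnerProductSpace.continuousLinearMapOfBilin_apply]
  exact hT x y

theorem le_of_re_inner_le [CompleteSpace H] {S T : H →L[ℂ] H} (hS : IsSelfAdjoint S)
    (hT : IsSelfAdjoint T) (h : ∀ x, (inner ℂ (S x) x).re ≤ (inner ℂ (T x) x).re) : S ≤ T := by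
  rw [ContinuousLinearMap.le_def, ContinuousLinearMap.isPositive_def']
  refine ⟨hT.sub hS, fun x => ?_⟩
  simpa [ContinuousLinearMap.reApplyInnerSelf, inner_sub_left] using h x

/-- A bounded downward directed set of self-adjoint operators has a lower bound that is
approximated by the set in the weak operator topology. -/
theorem exists_directed_inf [CompleteSpace H] {S : Set (H →L[ℂ] H)} (hne : S.Nonempty)
    (hsa : ∀ b ∈ S, IsSelfAdjoint b) {M : ℝ} (hM : ∀ b ∈ S, ‖b‖ ≤ M)
    (hdir : ∀ b ∈ S, ∀ c ∈ S, ∃ d ∈ S, d ≤ b ∧ d ≤ c) :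
    ∃ d : H →L[ℂ] H, IsSelfAdjoint d ∧ (∀ b ∈ S, d ≤ b) ∧
      (∀ x : H, ∀ ε > 0, ∃ b ∈ S, (inner ℂ (b x) x).re ≤ (inner ℂ (d x) x).re + ε) ∧
      ∀ T : H →L[ℂ] H, (∀ b ∈ S, T * b = b * T) → T * d = d * T := by
  have : Nonempty S := hne.to_subtype
  -- An ultrafilter containing all tails `{c ∈ S | c ≤ b}` is eventually below each `b`, so its weak
  -- limit is a lower bound of `S`.
  have hF : (⨅ b : S, 𝓟 {c | c ∈ S ∧ c ≤ b.1}).NeBot := by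
    refine iInf_neBot_of_directed (fun b c => ?_) fun b => ?_
    · obtain ⟨d, hd, hdb, hdc⟩ := hdir b b.2 c c.2
      exact ⟨⟨d, hd⟩, principal_mono.2 fun e he => ⟨he.1, he.2.trans hdb⟩,
        principal_mono.2 fun e he => ⟨he.1, he.2.trans hdc⟩⟩
    · exact principal_neBot_iff.2 ⟨b, b.2, le_rfl⟩
  set 𝒰 := Ultrafilter.of (⨅ b : S, 𝓟 {c | c ∈ S ∧ c ≤ b.1}) with h𝒰
  have hev : ∀ b ∈ S, ∀ᶠ c in (𝒰 : Filter (H →L[ℂ] H)), c ∈ S ∧ c ≤ b := fun b hb =>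
    (Ultrafilter.of_le _).trans (iInf_le _ (⟨b, hb⟩ : S)) (mem_principal_self _)
  have hS : ∀ᶠ c in (𝒰 : Filter (H →L[ℂ] H)), c ∈ S := by
    obtain ⟨b, hb⟩ := hne
    exact (hev b hb).mono fun _ h => h.1
  obtain ⟨d, hd⟩ := exists_weak_limit 𝒰 (hS.mono hM)
  have hdsa : IsSelfAdjoint d := by
    rw [ContinuousLinearMap.isSelfAdjoint_iff_isSymmetric]
    intro x y
    refine tendsto_nhds_unique (hd x y) ?_
    have h1 := (Complex.continuous_conj.tendsto _).comp (hd y x)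
    simp only [inner_conj_symm] at h1
    refine h1.congr' ?_
    filter_upwards [hS] with c hc
    simp only [Function.comp_apply, inner_conj_symm]
    exact ((ContinuousLinearMap.isSelfAdjoint_iff_isSymmetric.1 (hsa c hc)) x y).symm
  have hre : ∀ x, Tendsto (fun c : H →L[ℂ] H => (inner ℂ (c x) x).re) 𝒰
      (𝓝 (inner ℂ (d x) x).re) := fun x => (Complex.continuous_re.tendsto _).comp (hd x x)
  refine ⟨d, hdsa, fun b hb => ?_, fun x ε hε => ?_, fun T hT => ?_⟩
  · refine le_of_re_inner_le hdsa (hsa b hb) fun x => ?_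
    exact le_of_tendsto (hre x) ((hev b hb).mono fun c hc => re_inner_apply_mono hc.2 x)
  · obtain ⟨c, hc, hc'⟩ := (hS.and ((hre x).eventually_lt_const
      (show (inner ℂ (d x) x).re < (inner ℂ (d x) x).re + ε by linarith))).exists
    exact ⟨c, hc, hc'.le⟩
  · ext x
    refine ext_inner_right ℂ fun y => ?_
    rw [mul_apply_eq_comp, mul_apply_eq_comp, ← ContinuousLinearMap.adjoint_inner_right]
    refine tendsto_nhds_unique (hd x _) ((hd (T x) y).congr' ?_)
    filter_upwards [hS] with c hc
    rw [ContinuousLinearMap.adjoint_inner_right, ← mul_apply_eq_comp, ← mul_apply_eq_comp,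
      hT c hc]

end DirectedInf

/-! ### Contexts as commutative C*-algebras -/

section Gelfand

theorem _root_.VonNeumannAlgebra.isClosed {H : Type u} [NormedAddCommGroup H]
    [InnerProductSpace ℂ H] [CompleteSpace H] (S : VonNeumannAlgebra H) :
    IsClosed (S : Set (H →L[ℂ] H)) := by
  rw [← S.centralizer_centralizer]
  exact Set.isClosed_centralizer _

variable {H : Type u} [NormedAddCommGroup H] [InnerProductSpace ℂ H] [CompleteSpace H]
  {A : VonNeumannAlgebra H} {C : Context A}

noncomputable instance : CommCStarAlgebra C.carrier :=
  letI : IsClosed (C.alg.toStarSubalgebra : Set (H →L[ℂ] H)) := C.alg.isClosed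
  { StarSubalgebra.cstarAlgebra C.alg.toStarSubalgebra with
    mul_comm := fun x y => Subtype.ext (C.comm _ x.2 _ y.2) }

theorem Context.isSelfAdjoint_coe {b : C.carrier} (hb : IsSelfAdjoint b) :
    IsSelfAdjoint (b : H →L[ℂ] H) :=
  congrArg Subtype.val hb

theorem Context.coe_cfc {b : C.carrier} (hb : IsSelfAdjoint b) {f : ℝ → ℝ} (hf : Continuous f) :
    ((cfc f b : C.carrier) : H →L[ℂ] H) = cfc f (b : H →L[ℂ] H) :=
  StarAlgHomClass.map_cfc C.alg.toStarSubalgebra.subtype f b hf.continuousOn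
    continuous_subtype_val hb (Context.isSelfAdjoint_coe hb)

theorem Context.ofReal_re_char {b : C.carrier} (hb : IsSelfAdjoint b) (χ : C.spectrum) :
    ((χ b).re : ℂ) = χ b :=
  Complex.conj_eq_iff_re.1 (hb.map χ)

theorem Context.char_cfc {b : C.carrier} (hb : IsSelfAdjoint b) {f : ℝ → ℝ}
    (hf : Continuous f) (χ : C.spectrum) : χ (cfc f b) = (f (χ b).re : ℂ) := by
  have h : χ (cfc f b) = cfc f (χ b) :=
    StarAlgHomClass.map_cfc χ f b hf.continuousOn (map_continuous χ) hb (hb.map χ)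
  have h' : cfc f (algebraMap ℝ ℂ (χ b).re) = algebraMap ℝ ℂ (f (χ b).re) :=
    cfc_algebraMap _ _
  rw [h, ← Context.ofReal_re_char hb χ]
  exact h'

theorem Context.eq_zero_of_char {b : C.carrier} (h : ∀ χ : C.spectrum, χ b = 0) : b = 0 :=
  (gelfandTransform_isometry C.carrier).injective (by ext χ; simpa using h χ)

/-- Both sides say that the negative part of `b` is zero; functional calculus is the same in `C` as
on `H`, and the Gelfand transform is injective. -/
theorem Context.nonneg_iff_char {b : C.carrier} (hb : IsSelfAdjoint b) :
    0 ≤ (b : H →L[ℂ] H) ↔ ∀ χ : C.spectrum, 0 ≤ (χ b).re := by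
  have hf : Continuous fun r : ℝ => max (-r) 0 := by fun_prop
  have hb' := Context.isSelfAdjoint_coe hb
  constructor
  · intro h χ
    have h1 : cfc (fun r : ℝ => max (-r) 0) (b : H →L[ℂ] H) = 0 := by
      have : cfc (fun r : ℝ => max (-r) 0) (b : H →L[ℂ] H) =
          cfc (fun _ : ℝ => (0 : ℝ)) (b : H →L[ℂ] H) :=
        cfc_congr fun r hr => max_eq_right (neg_nonpos.2 (spectrum_nonneg_of_nonneg h hr))
      rw [this, cfc_const_zero]
    have h2 : cfc (fun r : ℝ => max (-r) 0) b = 0 :=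
      Subtype.ext ((Context.coe_cfc hb hf).trans h1)
    have h3 := Context.char_cfc hb hf χ
    rw [h2, map_zero] at h3
    have h3 := Complex.ofReal_eq_zero.1 h3.symm
    have := le_max_left (-(χ b).re) 0
    linarith
  · intro h
    have h1 : cfc (fun r : ℝ => max (-r) 0) b = 0 := by
      refine Context.eq_zero_of_char fun χ => ?_
      rw [Context.char_cfc hb hf, max_eq_right (neg_nonpos.2 (h χ)), Complex.ofReal_zero]
    have h2 : cfc (fun r : ℝ => max (-r) 0) (b : H →L[ℂ] H) = 0 := by
      rw [← Context.coe_cfc hb hf, h1]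
      rfl
    have h3 := cfc_sub (fun r : ℝ => max r 0) (fun r : ℝ => max (-r) 0) (b : H →L[ℂ] H)
      (by fun_prop) (by fun_prop)
    have h4 : (fun r : ℝ => max r 0 - max (-r) 0) = fun r => r := by
      funext r
      rcases le_total r 0 with h | h <;> simp [h]
    rw [h4, cfc_id' ℝ (b : H →L[ℂ] H) hb', h2, sub_zero] at h3
    rw [h3]
    exact cfc_nonneg fun r _ => le_max_right _ _

theorem Context.le_iff_char {b c : C.carrier} (hb : IsSelfAdjoint b) (hc : IsSelfAdjoint c) :
    (b : H →L[ℂ] H) ≤ c ↔ ∀ χ : C.spectrum, (χ b).re ≤ (χ c).re := by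
  have h := Context.nonneg_iff_char (hc.sub hb)
  have e : ((c - b : C.carrier) : H →L[ℂ] H) = (c : H →L[ℂ] H) - b := rfl
  rw [e, sub_nonneg] at h
  rw [h]
  simp [map_sub]

/-- A character sends the product for `t` to `(χ b - t)⁺ (t - χ c)⁺`, which is nonzero exactly when
`χ c < t < χ b`. -/
theorem Context.spectralLE_iff_char {b c : C.carrier} (hb : IsSelfAdjoint b)
    (hc : IsSelfAdjoint c) :
    SpectralLE (b : H →L[ℂ] H) c ↔ ∀ χ : C.spectrum, (χ b).re ≤ (χ c).re := by
  have h1 (t : ℝ) : Continuous fun r : ℝ => max (r - t) 0 := by fun_prop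
  have h2 (t : ℝ) : Continuous fun r : ℝ => max (t - r) 0 := by fun_prop
  have key (t : ℝ) (χ : C.spectrum) :
      χ (cfc (fun r : ℝ => max (r - t) 0) b * cfc (fun r : ℝ => max (t - r) 0) c) =
        ((max ((χ b).re - t) 0 * max (t - (χ c).re) 0 : ℝ) : ℂ) := by
    rw [map_mul, Context.char_cfc hb (h1 t), Context.char_cfc hc (h2 t), Complex.ofReal_mul]
  rw [spectralLE_iff_mul_eq_zero (Context.isSelfAdjoint_coe hb) (Context.isSelfAdjoint_coe hc)]
  constructor
  · intro h χ
    by_contra! hlt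
    obtain ⟨t, ht, ht'⟩ := exists_between hlt
    have h0 : cfc (fun r : ℝ => max (r - t) 0) b * cfc (fun r : ℝ => max (t - r) 0) c = 0 := by
      refine Subtype.ext ?_
      rw [MulMemClass.coe_mul, Context.coe_cfc hb (h1 t), Context.coe_cfc hc (h2 t), h t]
      rfl
    have h3 := key t χ
    rw [h0, map_zero] at h3
    have h4 := Complex.ofReal_eq_zero.1 h3.symm
    rw [max_eq_left (by linarith), max_eq_left (by linarith)] at h4
    exact (mul_pos (sub_pos.2 ht') (sub_pos.2 ht)).ne' h4
  · intro h t
    have h0 : cfc (fun r : ℝ => max (r - t) 0) b * cfc (fun r : ℝ => max (t - r) 0) c = 0 := by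
      refine Context.eq_zero_of_char fun χ => ?_
      rw [key, Complex.ofReal_eq_zero]
      rcases le_total (χ b).re t with h' | h'
      · rw [max_eq_right (by linarith), zero_mul]
      · rw [max_eq_right (a := t - _) (by linarith [h χ]), mul_zero]
    rw [← Context.coe_cfc hb (h1 t), ← Context.coe_cfc hc (h2 t), ← MulMemClass.coe_mul, h0]
    rfl

theorem Context.spectralLE_iff_le {b c : C.carrier} (hb : IsSelfAdjoint b)
    (hc : IsSelfAdjoint c) : SpectralLE (b : H →L[ℂ] H) c ↔ (b : H →L[ℂ] H) ≤ c :=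
  (Context.spectralLE_iff_char hb hc).trans (Context.le_iff_char hb hc).symm

end Gelfand
/-! ### Existence of the daseinisations -/

section Existence

variable {H : Type u} [NormedAddCommGroup H] [InnerProductSpace ℂ H] [CompleteSpace H]
  {A : VonNeumannAlgebra H} {C : Context A}

/-- The adjoint form puts `b` outermost: the positive operator `(t - b)⁺` must kill vectors that do
not depend on `b`, a condition inherited by smaller positive operators. -/
theorem spectralLE_iff_apply {a b : H →L[ℂ] H} (ha : IsSelfAdjoint a) (hb : IsSelfAdjoint b) :
    SpectralLE a b ↔ ∀ (t : ℝ) (x : H),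
      cfc (fun r : ℝ => max (t - r) 0) b (cfc (fun r : ℝ => max (r - t) 0) a x) = 0 := by
  rw [spectralLE_iff_mul_eq_zero ha hb]
  refine forall_congr' fun t => ?_
  rw [← star_eq_zero, star_mul, IsSelfAdjoint.cfc.star_eq, IsSelfAdjoint.cfc.star_eq,
    ContinuousLinearMap.ext_iff]
  rfl

theorem Context.cfc_le_of_char {b d : C.carrier} (hb : IsSelfAdjoint b) (hd : IsSelfAdjoint d)
    {f : ℝ → ℝ} (hf : Continuous f) (h : ∀ χ : C.spectrum, f (χ b).re ≤ (χ d).re) :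
    cfc f (b : H →L[ℂ] H) ≤ d := by
  have hfb : IsSelfAdjoint (cfc f b) := IsSelfAdjoint.cfc
  rw [← Context.coe_cfc hb hf]
  refine (Context.le_iff_char hfb hd).2 fun χ => ?_
  rw [Context.char_cfc hb hf, Complex.ofReal_re]
  exact h χ

/-- The minimum of two elements of a context. -/
noncomputable def Context.inf (b c : C.carrier) : C.carrier :=
  b - cfc (fun r : ℝ => max r 0) (b - c)

theorem Context.isSelfAdjoint_inf {b : C.carrier} (hb : IsSelfAdjoint b) (c : C.carrier) :
    IsSelfAdjoint (Context.inf b c) :=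
  hb.sub IsSelfAdjoint.cfc

theorem Context.re_char_inf {b c : C.carrier} (hb : IsSelfAdjoint b) (hc : IsSelfAdjoint c)
    (χ : C.spectrum) : (χ (Context.inf b c)).re = min (χ b).re (χ c).re := by
  rw [Context.inf, map_sub, Context.char_cfc (hb.sub hc) (by fun_prop), map_sub, Complex.sub_re,
    Complex.ofReal_re, Complex.sub_re]
  rcases le_total (χ b).re (χ c).re with h | h
  · rw [max_eq_right (by linarith), min_eq_left h, sub_zero]
  · rw [max_eq_left (by linarith), min_eq_right h]
    ring

theorem Context.inf_le_left {b c : C.carrier} (hb : IsSelfAdjoint b) (hc : IsSelfAdjoint c) :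
    (Context.inf b c : H →L[ℂ] H) ≤ b :=
  (Context.le_iff_char (Context.isSelfAdjoint_inf hb c) hb).2 fun χ =>
    (Context.re_char_inf hb hc χ).trans_le (min_le_left _ _)

theorem Context.inf_le_right {b c : C.carrier} (hb : IsSelfAdjoint b) (hc : IsSelfAdjoint c) :
    (Context.inf b c : H →L[ℂ] H) ≤ c :=
  (Context.le_iff_char (Context.isSelfAdjoint_inf hb c) hc).2 fun χ =>
    (Context.re_char_inf hb hc χ).trans_le (min_le_right _ _)

theorem Context.spectralLE_inf {a : H →L[ℂ] H} (ha : IsSelfAdjoint a) {b c : C.carrier}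
    (hb : IsSelfAdjoint b) (hc : IsSelfAdjoint c) (hab : SpectralLE a b) (hac : SpectralLE a c) :
    SpectralLE a (Context.inf b c : H →L[ℂ] H) := by
  have hm := Context.isSelfAdjoint_inf hb c
  have hf (t : ℝ) : Continuous fun r : ℝ => max (t - r) 0 := by fun_prop
  rw [spectralLE_iff_apply ha (Context.isSelfAdjoint_coe hm)]
  rw [spectralLE_iff_apply ha (Context.isSelfAdjoint_coe hb)] at hab
  rw [spectralLE_iff_apply ha (Context.isSelfAdjoint_coe hc)] at hac
  intro t x
  -- Pointwise, `(t - min b c)⁺` is one of the two nonnegative summands.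
  have hle : cfc (fun r : ℝ => max (t - r) 0) (Context.inf b c : H →L[ℂ] H) ≤
      cfc (fun r : ℝ => max (t - r) 0) (b : H →L[ℂ] H) +
        cfc (fun r : ℝ => max (t - r) 0) (c : H →L[ℂ] H) := by
    have hd : IsSelfAdjoint (cfc (fun r : ℝ => max (t - r) 0) b +
        cfc (fun r : ℝ => max (t - r) 0) c) := IsSelfAdjoint.add IsSelfAdjoint.cfc IsSelfAdjoint.cfc
    rw [← Context.coe_cfc hb (hf t), ← Context.coe_cfc hc (hf t)]
    refine Context.cfc_le_of_char hm hd (hf t) fun χ => ?_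
    rw [map_add, Complex.add_re, Context.char_cfc hb (hf t),
      Context.char_cfc hc (hf t), Complex.ofReal_re, Complex.ofReal_re,
      Context.re_char_inf hb hc]
    have h1 := le_max_right (t - (χ b).re) 0
    have h2 := le_max_right (t - (χ c).re) 0
    rcases min_choice (χ b).re (χ c).re with h | h <;> rw [h] <;> linarith
  refine apply_eq_zero_of_le (cfc_nonneg fun r _ => le_max_right _ _) hle ?_
  rw [add_apply, hab, hac, add_zero]

variable (C) in
/-- A real scalar as an element of a context. -/
noncomputable def Context.scalar (r : ℝ) : C.carrier := algebraMap ℝ C.carrier r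

theorem Context.isSelfAdjoint_scalar (r : ℝ) : IsSelfAdjoint (C.scalar r) :=
  .algebraMap _ (.all _)

/-- The set of all `b` in a context with `a ≤ₛ b` has a least element. -/
theorem exists_isLeast_outerSet {a : H →L[ℂ] H} (ha : IsSelfAdjoint a) (C : Context A) :
    ∃ d, IsLeast (outerSet a C) d := by
  have hM := C.isSelfAdjoint_scalar ‖a‖
  have haM : SpectralLE a (C.scalar ‖a‖ : H →L[ℂ] H) := spectralLE_algebraMap_norm ha
  have hlow : ∀ b : C.carrier, IsSelfAdjoint b → SpectralLE a b →
      -algebraMap ℝ (H →L[ℂ] H) ‖a‖ ≤ b := fun b hb hab =>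
    (Context.spectralLE_iff_le hM.neg hb).1 ((spectralLE_neg_algebraMap_norm ha).trans hab)
  -- Truncation at `‖a‖` bounds the set from above; the lower bound `-‖a‖` is automatic from `-‖a‖
  -- ≤ₛ a ≤ₛ b`.
  let S : Set (H →L[ℂ] H) := {T | ∃ b : C.carrier, IsSelfAdjoint b ∧ SpectralLE a b ∧
    (b : H →L[ℂ] H) ≤ C.scalar ‖a‖ ∧ b = T}
  obtain ⟨d, hd, hdS, happrox, hcomm⟩ := exists_directed_inf (S := S)
    ⟨_, C.scalar ‖a‖, hM, haM, le_rfl, rfl⟩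
    (by rintro _ ⟨b, hb, -, -, rfl⟩; exact Context.isSelfAdjoint_coe hb)
    -- From `0 ≤ b + ‖a‖ ≤ ‖a‖ + ‖a‖` and `b = (b + ‖a‖) - ‖a‖`.
    (M := ‖algebraMap ℝ (H →L[ℂ] H) ‖a‖ + algebraMap ℝ (H →L[ℂ] H) ‖a‖‖ +
      ‖algebraMap ℝ (H →L[ℂ] H) ‖a‖‖)
    (by
      rintro _ ⟨b, hb, hab, hbM, rfl⟩
      have h1 : 0 ≤ (b : H →L[ℂ] H) + algebraMap ℝ (H →L[ℂ] H) ‖a‖ :=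
        neg_le_iff_add_nonneg.1 (hlow b hb hab)
      have h2 := CStarAlgebra.norm_le_norm_of_nonneg_of_le h1 (add_le_add_left hbM _)
      calc ‖(b : H →L[ℂ] H)‖ = ‖((b : H →L[ℂ] H) + algebraMap ℝ (H →L[ℂ] H) ‖a‖) -
            algebraMap ℝ (H →L[ℂ] H) ‖a‖‖ := by rw [add_sub_cancel_right]
        _ ≤ _ := (norm_sub_le _ _).trans (by gcongr; exact h2))
    (by
      rintro _ ⟨b, hb, hab, hbM, rfl⟩ _ ⟨c, hc, hac, hcM, rfl⟩
      exact ⟨_, ⟨Context.inf b c, Context.isSelfAdjoint_inf hb c,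
        Context.spectralLE_inf ha hb hc hab hac, (Context.inf_le_left hb hc).trans hbM, rfl⟩,
        Context.inf_le_left hb hc, Context.inf_le_right hb hc⟩)
  have hdC : d ∈ C.alg.toStarSubalgebra := by
    change d ∈ C.alg
    rw [← C.alg.commutant_commutant, VonNeumannAlgebra.mem_commutant_iff]
    intro T hT
    refine hcomm T ?_
    rintro _ ⟨b, -, -, -, rfl⟩
    exact (VonNeumannAlgebra.mem_commutant_iff.1 hT _ b.2).symm
  obtain ⟨d, rfl⟩ : ∃ d' : C.carrier, (d' : H →L[ℂ] H) = d := ⟨⟨d, hdC⟩, rfl⟩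
  have hd : IsSelfAdjoint d := Subtype.ext hd
  have hf (t : ℝ) : Continuous fun r : ℝ => max (t - r) 0 := by fun_prop
  refine ⟨⟨d, hd⟩, ?_, ?_⟩
  · refine (spectralLE_iff_apply ha (Context.isSelfAdjoint_coe hd)).2 fun t x => ?_
    refine apply_eq_zero_of_re_inner_nonpos (cfc_nonneg fun r _ => le_max_right _ _) ?_
    refine le_of_forall_pos_le_add fun ε hε => ?_
    obtain ⟨_, ⟨b, hb, hab, hbM, rfl⟩, hbε⟩ :=
      happrox (cfc (fun r : ℝ => max (r - t) 0) a x) ε hε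
    have hdb := (Context.le_iff_char hd hb).1 (hdS _ ⟨b, hb, hab, hbM, rfl⟩)
    -- Here `r ↦ (t - r)⁺` is 1-Lipschitz and `d ≤ b`. At the vector `(a - t)⁺ x` the first term
    -- vanishes and the second contributes at most `ε`.
    have hle : cfc (fun r : ℝ => max (t - r) 0) (d : H →L[ℂ] H) ≤
        cfc (fun r : ℝ => max (t - r) 0) (b : H →L[ℂ] H) + (b - d) := by
      have hs : IsSelfAdjoint (cfc (fun r : ℝ => max (t - r) 0) b + (b - d)) :=
        IsSelfAdjoint.add IsSelfAdjoint.cfc (hb.sub hd)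
      rw [← Context.coe_cfc hb (hf t)]
      refine Context.cfc_le_of_char hd hs (hf t) fun χ => ?_
      rw [map_add, map_sub, Complex.add_re, Complex.sub_re,
        Context.char_cfc hb (hf t), Complex.ofReal_re]
      refine max_le ?_ ?_
      · linarith [le_max_left (t - (χ b).re) 0]
      · linarith [le_max_right (t - (χ b).re) 0, hdb χ]
    refine (re_inner_apply_mono hle _).trans ?_
    rw [add_apply, (spectralLE_iff_apply ha (Context.isSelfAdjoint_coe hb)).1 hab, zero_add,
      sub_apply, inner_sub_left, Complex.sub_re]
    linarith
  · intro b hab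
    refine (Context.spectralLE_iff_le hd b.isSelfAdjoint).2 ?_
    -- An arbitrary `b` need not lie in `S`, but its minimum with `‖a‖` does.
    exact (hdS _ ⟨Context.inf b.val (C.scalar ‖a‖), Context.isSelfAdjoint_inf b.isSelfAdjoint _,
      Context.spectralLE_inf ha b.isSelfAdjoint hM hab haM,
      Context.inf_le_right b.isSelfAdjoint hM, rfl⟩).trans
      (Context.inf_le_left b.isSelfAdjoint hM)

/-- The negative of a self-adjoint element of a context. -/
noncomputable def SelfAdjointPart.neg (b : SelfAdjointPart C) : SelfAdjointPart C :=
  ⟨-b.val, b.isSelfAdjoint.neg⟩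

theorem SelfAdjointPart.coe_neg (b : SelfAdjointPart C) :
    (b.neg.val : H →L[ℂ] H) = -(b.val : H →L[ℂ] H) :=
  rfl

/-- A self-adjoint element of a context, viewed in a larger context. -/
def SelfAdjointPart.inclusion {C C' : Context A} (h : C ≤ C') (b : SelfAdjointPart C) :
    SelfAdjointPart C' where
  val := ⟨b.val, h b.val.2⟩
  isSelfAdjoint := by
    have hb : star (b.val : H →L[ℂ] H) = b.val := Context.isSelfAdjoint_coe b.isSelfAdjoint
    exact Subtype.ext hb

/-- The set of all `b` in a context with `b ≤ₛ a` has a greatest element. -/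
theorem exists_isGreatest_innerSet {a : H →L[ℂ] H} (ha : IsSelfAdjoint a) (C : Context A) :
    ∃ d, IsGreatest (innerSet a C) d := by
  obtain ⟨d, hd, hleast⟩ := exists_isLeast_outerSet ha.neg C
  have hd' := Context.isSelfAdjoint_coe d.isSelfAdjoint
  refine ⟨d.neg, ?_, fun b hb => ?_⟩
  · have h := SpectralLE.neg ha.neg hd' hd
    rw [neg_neg a] at h
    rw [innerSet, Set.mem_ofPred_eq, SelfAdjointPart.coe_neg]
    exact h
  · have hb' := Context.isSelfAdjoint_coe b.isSelfAdjoint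
    have hmem : b.neg ∈ outerSet (-a) C := by
      rw [outerSet, Set.mem_ofPred_eq, SelfAdjointPart.coe_neg]
      exact SpectralLE.neg hb' ha hb
    have h : SpectralLE (d.val : H →L[ℂ] H) (b.neg.val : H →L[ℂ] H) := hleast hmem
    rw [SelfAdjointPart.coe_neg] at h
    have h' := SpectralLE.neg hd' hb'.neg h
    rw [neg_neg (b.val : H →L[ℂ] H)] at h'
    change SpectralLE (b.val : H →L[ℂ] H) (d.neg.val : H →L[ℂ] H)
    rw [SelfAdjointPart.coe_neg]
    exact h'

theorem isGLB_outerDas {a : H →L[ℂ] H} (ha : IsSelfAdjoint a) (C : Context A) :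
    IsGLB (outerSet a C) (outerDas a C) := by
  obtain ⟨d, hd⟩ := exists_isLeast_outerSet ha C
  have h : ∃ d, IsGLB (outerSet a C) d := ⟨d, hd.isGLB⟩
  rw [outerDas, dif_pos h]
  exact h.choose_spec

theorem isLUB_innerDas {a : H →L[ℂ] H} (ha : IsSelfAdjoint a) (C : Context A) :
    IsLUB (innerSet a C) (innerDas a C) := by
  obtain ⟨d, hd⟩ := exists_isGreatest_innerSet ha C
  have h : ∃ d, IsLUB (innerSet a C) d := ⟨d, hd.isLUB⟩
  rw [innerDas, dif_pos h]
  exact h.choose_spec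

/-- An infimum alone need not lie in the set; this one does because it dominates a least element. -/
theorem spectralLE_outerDas {a : H →L[ℂ] H} (ha : IsSelfAdjoint a) (C : Context A) :
    SpectralLE a ((outerDas a C).val : H →L[ℂ] H) := by
  obtain ⟨d, hd⟩ := exists_isLeast_outerSet ha C
  exact hd.1.trans ((isGLB_outerDas ha C).2 hd.2)

theorem innerDas_spectralLE {a : H →L[ℂ] H} (ha : IsSelfAdjoint a) (C : Context A) :
    SpectralLE ((innerDas a C).val : H →L[ℂ] H) a := by
  obtain ⟨d, hd⟩ := exists_isGreatest_innerSet ha C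
  exact SpectralLE.trans ((isLUB_innerDas ha C).2 hd.2) hd.1

/-- The `min` in `IntervalDomain.mk` is harmless since `δⁱ(a)_C ≤ₛ a ≤ₛ δᵒ(a)_C`. -/
theorem lo_covDas {a : H →L[ℂ] H} (ha : IsSelfAdjoint a) (x : SpectralBundle A) :
    (covDas a x).lo = (x.char (innerDas a x.ctx).val).re :=
  min_eq_left ((Context.spectralLE_iff_char (innerDas a x.ctx).isSelfAdjoint
    (outerDas a x.ctx).isSelfAdjoint).1
      ((innerDas_spectralLE ha _).trans (spectralLE_outerDas ha _)) x.char)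

theorem hi_covDas {a : H →L[ℂ] H} (ha : IsSelfAdjoint a) (x : SpectralBundle A) :
    (covDas a x).hi = (x.char (outerDas a x.ctx).val).re :=
  max_eq_right ((Context.spectralLE_iff_char (innerDas a x.ctx).isSelfAdjoint
    (outerDas a x.ctx).isSelfAdjoint).1
      ((innerDas_spectralLE ha _).trans (spectralLE_outerDas ha _)) x.char)

end Existence

/-! ### Continuity of covariant daseinisation -/

namespace IntervalDomain

/-- The sets `(p, q)_S` form a basis of the Scott topology. -/
theorem exists_basic_subset {U : Set IntervalDomain} (hU : IsOpen U) {I : IntervalDomain}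
    (hI : I ∈ U) : ∃ p q : ℚ, p < q ∧ I ∈ basic p q ∧ basic p q ⊆ U := by
  rw [Topology.IsScott.isOpen_iff_isUpperSet_and_dirSupInaccOn (D := Set.univ)] at hU
  obtain ⟨hup, hinacc⟩ := hU
  -- The enlarged intervals are directed with supremum `I`, so Scott openness puts one of them in
  -- `U`; rational endpoints are then chosen between it and `I`.
  let J : {δ : ℝ // 0 < δ} → IntervalDomain := fun δ => OrderDual.toDual
    (⟨(I.lo - δ, I.hi + δ), by linarith [I.lo_le_hi, δ.2]⟩ : NonemptyInterval ℝ)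
  have hlo : ∀ δ, (J δ).lo = I.lo - δ := fun _ => rfl
  have hhi : ∀ δ, (J δ).hi = I.hi + δ := fun _ => rfl
  have hmono : ∀ δ ε, δ ≤ ε → J ε ≤ J δ := fun δ ε h => by
    have h : δ.1 ≤ ε.1 := h
    rw [le_iff, hlo, hlo, hhi, hhi]
    constructor <;> linarith
  have hlub : IsLUB (Set.range J) I := by
    constructor
    · rintro _ ⟨δ, rfl⟩
      rw [le_iff, hlo, hhi]
      constructor <;> linarith [δ.2]
    · intro K hK
      rw [le_iff]
      constructor
      · refine le_of_forall_pos_le_add fun ε hε => ?_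
        have := (le_iff.1 (hK ⟨⟨ε, hε⟩, rfl⟩)).1
        rw [hlo] at this
        linarith
      · refine le_of_forall_pos_le_add fun ε hε => ?_
        have := (le_iff.1 (hK ⟨⟨ε, hε⟩, rfl⟩)).2
        rwa [hhi] at this
  have hdir : DirectedOn (· ≤ ·) (Set.range J) := by
    rintro _ ⟨δ, rfl⟩ _ ⟨ε, rfl⟩
    exact ⟨J (min δ ε), ⟨_, rfl⟩, hmono _ _ (min_le_left _ _), hmono _ _ (min_le_right _ _)⟩
  obtain ⟨_, ⟨δ, rfl⟩, hδ⟩ :=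
    hinacc (Set.mem_univ _) (Set.range_nonempty_iff_nonempty.2 ⟨⟨1, one_pos⟩⟩) hdir hlub hI
  obtain ⟨p, hp, hp'⟩ := exists_rat_btwn (show I.lo - δ < I.lo by linarith [δ.2])
  obtain ⟨q, hq, hq'⟩ := exists_rat_btwn (show I.hi < I.hi + δ by linarith [δ.2])
  refine ⟨p, q, ?_, ⟨hp', hq⟩, fun K hK => hup ?_ hδ⟩
  · exact_mod_cast hp'.trans_le (I.lo_le_hi.trans hq.le)
  · rw [le_iff, hlo, hhi]
    exact ⟨hp.le.trans hK.1.le, hK.2.le.trans hq'.le⟩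

end IntervalDomain

section Continuity

variable {H : Type u} [NormedAddCommGroup H] [InnerProductSpace ℂ H] [CompleteSpace H]
  {A : VonNeumannAlgebra H}

theorem isOpen_preimage_basic {a : H →L[ℂ] H} (ha : IsSelfAdjoint a) (p q : ℚ) :
    IsOpen ((covDas a : SpectralBundle A → IntervalDomain) ⁻¹' IntervalDomain.basic p q) := by
  have hmem : ∀ x : SpectralBundle A, x ∈ covDas a ⁻¹' IntervalDomain.basic p q ↔
      (p : ℝ) < (x.char (innerDas a x.ctx).val).re ∧
        (x.char (outerDas a x.ctx).val).re < q := fun x => by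
    rw [← lo_covDas ha, ← hi_covDas ha]
    rfl
  refine ⟨fun C => ?_, fun C C' h χ χ' hχ hx => ?_⟩
  · have hc (b : C.carrier) : Continuous fun χ : C.spectrum => (χ b).re :=
      Complex.continuous_re.comp ((WeakDual.eval_continuous b).comp continuous_subtype_val)
    simp only [hmem]
    exact (isOpen_lt continuous_const (hc _)).inter (isOpen_lt (hc _) continuous_const)
  · rw [hmem] at hx ⊢
    -- The approximations from `C` still compete in `C'`, so those of `C'` are at least as sharp.
    let i : SelfAdjointPart C' := (innerDas a C).inclusion h
    let o : SelfAdjointPart C' := (outerDas a C).inclusion h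
    have hi : i ≤ innerDas a C' := (isLUB_innerDas ha C').1 (innerDas_spectralLE ha C)
    have ho : outerDas a C' ≤ o := (isGLB_outerDas ha C').1 (spectralLE_outerDas ha C)
    have hi' := (Context.spectralLE_iff_char i.isSelfAdjoint
      (innerDas a C').isSelfAdjoint).1 hi χ'
    have ho' := (Context.spectralLE_iff_char (outerDas a C').isSelfAdjoint
      o.isSelfAdjoint).1 ho χ'
    rw [show χ' i.val = _ from hχ _] at hi'
    rw [show χ' o.val = _ from hχ _] at ho'
    exact ⟨hx.1.trans_le hi', ho'.trans_lt hx.2⟩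

theorem continuous_covDas {a : H →L[ℂ] H} (ha : IsSelfAdjoint a) :
    Continuous (covDas a : SpectralBundle A → IntervalDomain) := by
  refine continuous_def.2 fun U hU => isOpen_iff_forall_mem_open.2 fun x hx => ?_
  obtain ⟨p, q, -, hxpq, hpq⟩ := IntervalDomain.exists_basic_subset hU hx
  exact ⟨_, Set.preimage_mono hpq, isOpen_preimage_basic ha p q, hxpq⟩

end Continuity
/-! ### Internal frame maps between opens of bundles -/

theorem InternalPoset.IsJoinAt.unique {P : Type u} [Preorder P] {L : InternalPoset.{u, v} P}
    {S : Subfunctor L.carrier} {C : P} {w w' : L.carrier.obj C} (h : L.IsJoinAt S C w)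
    (h' : L.IsJoinAt S C w') : w = w' := by
  have h1 := h.2 C (𝟙 C) w' h'.1
  have h2 := h'.2 C (𝟙 C) w h.1
  simp only [Functor.map_id_apply] at h1 h2
  exact le_antisymm h1 h2

section BundleMap

variable {P : Type u} [Preorder P] [TopologicalSpace P] [Topology.IsUpperSet P]

/-! ### Internal top, meets and joins of bundle opens, computed pointwise -/

section Characterizations

variable {Y : Type v} [TopologicalSpace Y] {π : Y → P} {hπ : Continuous π}

/-- The open subset of the total space underlying an open of a bundle at stage `C`. -/
def bundleOpens.toOpens {C : P} (U : (bundlePoset π hπ).carrier.obj C) : Opens Y :=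
  Subtype.val (p := fun U : Opens Y => ∀ y ∈ U, C ≤ π y) U

theorem bundleOpens.stage_le {C : P} (U : (bundlePoset π hπ).carrier.obj C) {y : Y}
    (hy : y ∈ bundleOpens.toOpens U) : C ≤ π y :=
  Subtype.prop (p := fun U : Opens Y => ∀ y ∈ U, C ≤ π y) U y hy

theorem bundleOpens.ext {C : P} {U V : (bundlePoset π hπ).carrier.obj C}
    (h : ∀ y, y ∈ bundleOpens.toOpens U ↔ y ∈ bundleOpens.toOpens V) : U = V :=
  Subtype.ext (Opens.ext (Set.ext h))

theorem bundlePoset_isTopAt_iff {C : P} {t : (bundlePoset π hπ).carrier.obj C} :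
    (bundlePoset π hπ).IsTopAt C t ↔ ∀ y, C ≤ π y → y ∈ bundleOpens.toOpens t := by
  constructor
  · intro h y hy
    let v : (bundlePoset π hπ).carrier.obj C := ⟨⟨π ⁻¹' Set.Ici C,
      (Topology.IsUpperSet.isOpen_iff_isUpperSet.2 (isUpperSet_Ici C)).preimage hπ⟩,
      fun _ hy => hy⟩
    exact (h C (𝟙 C) v hy).1
  · exact fun h D f v y hy =>
      ⟨h y (f.le.trans (bundleOpens.stage_le v hy)), bundleOpens.stage_le v hy⟩

theorem bundlePoset_isMeetAt_iff {C : P} {x y m : (bundlePoset π hπ).carrier.obj C} :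
    (bundlePoset π hπ).IsMeetAt C x y m ↔ ∀ z, z ∈ bundleOpens.toOpens m ↔
      z ∈ bundleOpens.toOpens x ∧ z ∈ bundleOpens.toOpens y := by
  constructor
  · intro h z
    have h' := h C (𝟙 C)
    simp only [Functor.map_id_apply] at h'
    refine ⟨fun hz => ⟨h'.1 (Set.mem_insert _ _) hz, h'.1 (Set.mem_insert_of_mem _ rfl) hz⟩,
      fun hz => ?_⟩
    let v : (bundlePoset π hπ).carrier.obj C :=
      ⟨bundleOpens.toOpens x ⊓ bundleOpens.toOpens y, fun z hz => bundleOpens.stage_le x hz.1⟩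
    have hv : v ≤ m := by
      refine h'.2 ?_
      rintro w (rfl | rfl)
      · exact fun z hz => hz.1
      · exact fun z hz => hz.2
    exact hv hz
  · intro h D f
    constructor
    · rintro w (rfl | rfl)
      · exact fun z hz => ⟨((h z).1 hz.1).1, hz.2⟩
      · exact fun z hz => ⟨((h z).1 hz.1).2, hz.2⟩
    · intro w hw z hz
      exact ⟨(h z).2 ⟨(hw (Set.mem_insert _ _) hz).1, (hw (Set.mem_insert_of_mem _ rfl) hz).1⟩,
        bundleOpens.stage_le w hz⟩

theorem bundlePoset_isJoinAt_iff {C : P} {S : Subfunctor (bundlePoset π hπ).carrier}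
    {w : (bundlePoset π hπ).carrier.obj C} :
    (bundlePoset π hπ).IsJoinAt S C w ↔ ∀ y, y ∈ bundleOpens.toOpens w ↔
      C ≤ π y ∧ ∃ D, ∃ s ∈ S.obj D, y ∈ bundleOpens.toOpens s := by
  -- Membership of `y` survives restriction to stage `π y`, so bounds need only be tested there,
  -- whatever stage `s` comes from.
  have hrestrict : ∀ {D : P} {s} {y : Y}, s ∈ S.obj D → y ∈ bundleOpens.toOpens s →
      ∃ s' ∈ S.obj (π y), y ∈ bundleOpens.toOpens s' := fun {D s y} hs hy =>
    ⟨_, S.map (homOfLE (bundleOpens.stage_le s hy)) hs, hy, le_rfl⟩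
  constructor
  · intro h y
    constructor
    · intro hy
      let T : Set (Opens Y) := {U | ∃ D, C ≤ D ∧ ∃ s ∈ S.obj D, bundleOpens.toOpens s = U}
      let v : (bundlePoset π hπ).carrier.obj C := ⟨sSup T, fun z hz => by
        obtain ⟨_, ⟨D, hD, s, -, rfl⟩, hz⟩ := Opens.mem_sSup.1 hz
        exact hD.trans (bundleOpens.stage_le s hz)⟩
      have hv := h.2 C (𝟙 C) v fun D f s hs z hz =>
        ⟨Opens.mem_sSup.2 ⟨_, ⟨D, f.le, s, hs, rfl⟩, hz⟩, bundleOpens.stage_le s hz⟩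
      have hyv : y ∈ sSup T := hv ⟨hy, bundleOpens.stage_le w hy⟩
      obtain ⟨_, ⟨D, -, s, hs, rfl⟩, hy'⟩ := Opens.mem_sSup.1 hyv
      exact ⟨bundleOpens.stage_le w hy, D, s, hs, hy'⟩
    · rintro ⟨hC, D, s, hs, hy⟩
      obtain ⟨s', hs', hy'⟩ := hrestrict hs hy
      exact (h.1 (π y) (homOfLE hC) s' hs' hy').1
  · intro h
    constructor
    · exact fun D f s hs y hy =>
        ⟨(h y).2 ⟨f.le.trans (bundleOpens.stage_le s hy), D, s, hs, hy⟩,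
          bundleOpens.stage_le s hy⟩
    · intro D f v hv y hy
      obtain ⟨-, E, s, hs, hy'⟩ := (h y).1 hy.1
      obtain ⟨s', hs', hy'⟩ := hrestrict hs hy'
      exact (hv (π y) (homOfLE hy.2) s' hs' hy').1

/-- An internal frame map out of the opens of a bundle is determined by its values on a basis. -/
theorem bundlePoset_hom_ext {M : InternalPoset.{u, v} P}
    {φ ψ : InternalFrameHom (bundlePoset π hπ) M}
    (G : ∀ C, Set ((bundlePoset π hπ).carrier.obj C))
    (hG : ∀ C (W : (bundlePoset π hπ).carrier.obj C), ∀ y ∈ bundleOpens.toOpens W,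
      ∃ u ∈ G C, y ∈ bundleOpens.toOpens u ∧ u ≤ W)
    (h : ∀ C, ∀ u ∈ G C, φ.toNatTrans.app C u = ψ.toNatTrans.app C u) : φ = ψ := by
  have key : φ.toNatTrans = ψ.toNatTrans := by
    ext C W
    -- The basic opens below `W`, with all their restrictions: a subobject whose join is `W`, and on
    -- which the two maps agree.
    let S : Subfunctor (bundlePoset π hπ).carrier :=
      { obj := fun D => {s | ∃ g : C ⟶ D, ∃ u ∈ G C, u ≤ W ∧
          (bundlePoset π hπ).carrier.map g u = s}
        map := by
          rintro D E f _ ⟨g, u, hu, huW, rfl⟩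
          exact ⟨g ≫ f, u, hu, huW, Functor.map_comp_apply _ _ _ _⟩ }
    have hS : (bundlePoset π hπ).IsJoinAt S C W := by
      refine bundlePoset_isJoinAt_iff.2 fun y => ⟨fun hy => ?_, ?_⟩
      · obtain ⟨u, hu, hyu, huW⟩ := hG C W y hy
        exact ⟨bundleOpens.stage_le W hy, C, _, ⟨𝟙 C, u, hu, huW, rfl⟩,
          hyu, bundleOpens.stage_le W hy⟩
      · rintro ⟨-, D, _, ⟨g, u, hu, huW, rfl⟩, hy⟩
        exact huW hy.1
    have himage : S.image φ.toNatTrans = S.image ψ.toNatTrans := by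
      ext D z
      refine exists_congr fun s => and_congr_right ?_
      rintro ⟨g, u, hu, huW, rfl⟩
      rw [NatTrans.naturality_apply, NatTrans.naturality_apply, h C u hu]
    have h1 := φ.map_join C S W hS
    have h2 := ψ.map_join C S W hS
    rw [himage] at h1
    exact h1.unique h2
  cases φ
  cases ψ
  cases key
  rfl

end Characterizations

variable {Y Z : Type v} [TopologicalSpace Y] [TopologicalSpace Z] {π : Y → P} {ρ : Z → P}
  (hπ : Continuous π) (hρ : Continuous ρ)

/-- A continuous map between bundles induces an internal frame map by taking preimages. -/
def bundlePreimage (f : Y → Z) (hf : Continuous f) (hfπ : ∀ y, ρ (f y) = π y) :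
    InternalFrameHom (bundlePoset ρ hρ) (bundlePoset π hπ) where
  toNatTrans :=
    { app := fun C => ↾fun U => ⟨(bundleOpens.toOpens (hπ := hρ) U).comap ⟨f, hf⟩, fun y hy =>
        (bundleOpens.stage_le (hπ := hρ) U hy).trans_eq (hfπ y)⟩
      naturality := fun C D g => by
        ext U
        refine bundleOpens.ext fun y => and_congr_right fun _ => ?_
        change D ≤ ρ (f y) ↔ D ≤ π y
        rw [hfπ] }
  map_top C t ht := by
    rw [bundlePoset_isTopAt_iff] at ht ⊢
    exact fun y hy => ht (f y) (hy.trans_eq (hfπ y).symm)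
  map_meet C x y m hm := by
    rw [bundlePoset_isMeetAt_iff] at hm ⊢
    exact fun z => hm (f z)
  map_join C S w hw := by
    rw [bundlePoset_isJoinAt_iff] at hw ⊢
    intro y
    refine (hw (f y)).trans ?_
    rw [hfπ]
    refine and_congr_right fun _ => exists_congr fun D => ⟨?_, ?_⟩
    · rintro ⟨s, hs, hy⟩
      exact ⟨_, ⟨s, hs, rfl⟩, hy⟩
    · rintro ⟨_, ⟨s, hs, rfl⟩, hy⟩
      exact ⟨s, hs, hy⟩

end BundleMap

/-! ### The internal locale map of daseinisation and its uniqueness -/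

section Main

variable {H : Type u} [NormedAddCommGroup H] [InnerProductSpace ℂ H] [CompleteSpace H]
  {A : VonNeumannAlgebra H}

/-- The internal locale map `Σ_* ⟶ IR` given by covariant daseinisation. -/
noncomputable def covDasLocaleMap {a : H →L[ℂ] H} (ha : IsSelfAdjoint a) :
    InternalLocaleMap (spectralLocale A) (intervalLocale A) where
  preimage := bundlePreimage continuous_ctx continuous_fst
    (fun x : SpectralBundle A => (x.ctx, covDas a x))
    (continuous_ctx.prodMk (continuous_covDas ha)) fun _ => rfl

theorem spectralOpenSet_covDasLocaleMap {a : H →L[ℂ] H} (ha : IsSelfAdjoint a)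
    {C C' : Context A} (h : C ≤ C') (p q : ℚ) :
    spectralOpenSet ((covDasLocaleMap ha).preimage.toNatTrans.app C (intervalBasic h p q)) =
      covDas a ⁻¹' IntervalDomain.basic p q ∩ {x | C' ≤ x.ctx} :=
  Set.ext fun _ => and_comm

theorem intervalLocaleMap_ext {δ ε : InternalLocaleMap (spectralLocale A) (intervalLocale A)}
    (h : ∀ (C C' : Context A) (hC : C ≤ C') (p q : ℚ), p < q →
      spectralOpenSet (δ.preimage.toNatTrans.app C (intervalBasic hC p q)) =
        spectralOpenSet (ε.preimage.toNatTrans.app C (intervalBasic hC p q))) : δ = ε := by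
  obtain ⟨φ⟩ := δ
  obtain ⟨ψ⟩ := ε
  congr 1
  refine bundlePoset_hom_ext (π := (Prod.fst : Context A × IntervalDomain → Context A))
    (hπ := continuous_fst)
    (fun C => {u | ∃ (C' : Context A) (hC : C ≤ C') (p q : ℚ), p < q ∧ intervalBasic hC p q = u})
    ?_ ?_
  · rintro C W ⟨D, I⟩ hy
    obtain ⟨U, V, hU, hV, hDU, hIV, hUV⟩ :=
      isOpen_prod_iff.1 (bundleOpens.toOpens W).isOpen D I hy
    obtain ⟨p, q, hpq, hI, hV'⟩ := IntervalDomain.exists_basic_subset hV hIV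
    -- In the Alexandrov topology `↑D` is the smallest neighbourhood of `D`, so it fits inside `U`.
    refine ⟨_, ⟨D, bundleOpens.stage_le W hy, p, q, hpq, rfl⟩, ⟨Set.self_mem_Ici, hI⟩, ?_⟩
    rintro ⟨E, J⟩ ⟨hE, hJ⟩
    exact hUV ⟨Topology.IsUpperSet.isOpen_iff_isUpperSet.1 hU hE hDU, hV' hJ⟩
  · rintro C _ ⟨C', hC, p, q, hpq, rfl⟩
    exact Subtype.ext (Opens.ext (h C C' hC p q hpq))

end Main
end Daseinisation

theorem proposition3p4 {H : Type*} [NormedAddCommGroup H] [InnerProductSpace ℂ H]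
    [CompleteSpace H] (A : VonNeumannAlgebra H) (a : H →L[ℂ] H) (ha : a ∈ A)
    (hsa : IsSelfAdjoint a) :
    -- inner and outer daseinisation exist in every context
    (∀ C : Daseinisation.Context A,
      IsLUB (Daseinisation.innerSet a C) (Daseinisation.innerDas a C) ∧
      IsGLB (Daseinisation.outerSet a C) (Daseinisation.outerDas a C)) ∧
    -- `δ(a)` takes `(C, χ)` to the interval `[χ(δⁱ(a)_C), χ(δᵒ(a)_C)]`
    (∀ x : Daseinisation.SpectralBundle A,
      ((Daseinisation.covDas a x).lo : ℂ) = x.char (Daseinisation.innerDas a x.ctx).val ∧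
      ((Daseinisation.covDas a x).hi : ℂ) = x.char (Daseinisation.outerDas a x.ctx).val) ∧
    -- `δ(a)` is continuous
    Continuous (Daseinisation.covDas a : Daseinisation.SpectralBundle A →
      Daseinisation.IntervalDomain) ∧
    -- the formula `↑C' × (p, q)_S ↦ δ(a)⁻¹(p, q)_S ∩ Σ_*|↑C'` at each stage `C ≤ C'` defines an
    -- internal frame map, that is, an internal locale map from `Σ_*` to the interval domain
    ∃! δ : Daseinisation.InternalLocaleMap (Daseinisation.spectralLocale A)
        (Daseinisation.intervalLocale A),
      ∀ (C C' : Daseinisation.Context A) (h : C ≤ C') (p q : ℚ), p < q →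
        Daseinisation.spectralOpenSet
            (δ.preimage.toNatTrans.app C (Daseinisation.intervalBasic h p q)) =
          Daseinisation.covDas a ⁻¹' Daseinisation.IntervalDomain.basic p q ∩
            {x | C' ≤ x.ctx} := by
  refine ⟨fun C => ⟨Daseinisation.isLUB_innerDas hsa C, Daseinisation.isGLB_outerDas hsa C⟩,
    fun x => ⟨?_, ?_⟩, Daseinisation.continuous_covDas hsa, Daseinisation.covDasLocaleMap hsa,
    fun C C' h p q _ => Daseinisation.spectralOpenSet_covDasLocaleMap hsa h p q, fun ε hε => ?_⟩
  · rw [Daseinisation.lo_covDas hsa, Daseinisation.Context.ofReal_re_char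
      (Daseinisation.innerDas a x.ctx).isSelfAdjoint]
  · rw [Daseinisation.hi_covDas hsa, Daseinisation.Context.ofReal_re_char
      (Daseinisation.outerDas a x.ctx).isSelfAdjoint]
  · exact Daseinisation.intervalLocaleMap_ext fun C C' h p q hpq => (hε C C' h p q hpq).trans
      (Daseinisation.spectralOpenSet_covDasLocaleMap hsa h p q).symm
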